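/- **Model.** Fix an upper bound $n$ on the number of nodes; nodes have unique identifiers in a set of size $n$. A dynamic network is a sequence of finite graphs $G_i=(V_i,E_i)$, $i\ge 0$, where $G_i$ is the graph at the beginning of round $i$. It starts with an empty (edgeless) graph, $E_0=\emptyset$, and between consecutive rounds an arbitrary set of topology changes may occur concurrently; a change is the insertion or deletion of an edge between two nodes that are present before and after, the insertion of a node together with its edges, or the deletion of a node together with its edges. In a deterministic distributed algorithm every node knows $n$, its identifier and the round number modulo $15n$; an inserted node starts in its initial state. In each round $i$ every node $v\in V_i$ learns its current neighbors and receives indications of the changes that have just occurred at it, then sends a (possibly different) message to each of its neighbors in $G_i$, receives the messages of its neighbors, and updates its local state. Its state determines a label in $\{\mathtt{true},\mathtt{false}\}$. The star of $v\in V_i$ is consistent in round $i$ if, for the labels at the beginning of round $i$, either $v$ is labeled $\mathtt{true}$ and all its neighbors in $G_i$ are labeled $\mathtt{false}$, or $v$ is labeled $\mathtt{false}$ and it has a neighbor in $G_i$ labeled $\mathtt{true}$ (so all stars are consistent if and only if the nodes labeled $\mathtt{true}$ form a maximal independent set of $G_i$). Let $\mathrm{incorrect}(i)$ be the number of rounds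 $j\le i$ in which some star is inconsistent, and let $\mathrm{changes}(i)$ be the number of topology changes that occurred until the beginning of round $i$. **Theorem.** There are a deterministic distributed algorithm (for all $n$) and constants $C$ and $k$ such that, for every $n\ge 2$, every message has at most $C\lfloor\log_2 n\rfloor$ bits, and, for every $n$, every dynamic network on at most $n$ nodes that starts with an empty graph, and every round $i$, $$\mathrm{incorrect}(i)\le k\cdot \mathrm{changes}(i).$$ That is, the algorithm fixes a maximal independent set under edge and node insertions and deletions in $O(1)$ amortized rounds, with $O(\log n)$-bit messages. -/

import Mathlib

namespace DynNet

/-- The topology of the network in one round: the set of nodes that are present (identifiers are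
taken from `Fin n`, so `n` bounds the number of nodes) and the graph on these nodes. -/
structure Topology (n : ℕ) where
  nodes : Finset (Fin n)
  graph : SimpleGraph (Fin n)
  mem_of_adj : ∀ u v, graph.Adj u v → u ∈ nodes ∧ v ∈ nodes

/-- Nodes inserted in the transition from `T` to `T'`. -/
def nodeInsertions {n : ℕ} (T T' : Topology n) : Set (Fin n) :=
  {v | v ∈ T'.nodes ∧ v ∉ T.nodes}

/-- Nodes deleted in the transition from `T` to `T'`. -/
def nodeDeletions {n : ℕ} (T T' : Topology n) : Set (Fin n) :=
  {v | v ∈ T.nodes ∧ v ∉ T'.nodes}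

/-- Edges inserted in the transition from `T` to `T'` between two nodes that were already
present. The edges with which a new node arrives are part of the insertion of that node. -/
def edgeInsertions {n : ℕ} (T T' : Topology n) : Set (Sym2 (Fin n)) :=
  {e | e ∈ T'.graph.edgeSet ∧ e ∉ T.graph.edgeSet ∧ ∀ v ∈ e, v ∈ T.nodes}

/-- Edges deleted in the transition from `T` to `T'` between two nodes that both stay.
The edges that vanish with a deleted node are part of the deletion of that node. -/
def edgeDeletions {n : ℕ} (T T' : Topology n) : Set (Sym2 (Fin n)) :=
  {e | e ∈ T.graph.edgeSet ∧ e ∉ T'.graph.edgeSet ∧ ∀ v ∈ e, v ∈ T'.nodes}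

/-- The number of topology changes (edge and node insertions and deletions) from `T` to `T'`. -/
noncomputable def changeCount {n : ℕ} (T T' : Topology n) : ℕ :=
  (nodeInsertions T T').ncard + (nodeDeletions T T').ncard +
    (edgeInsertions T T').ncard + (edgeDeletions T T').ncard

/-- A dynamic network: `topo i` is the graph at the beginning of round `i`. It starts without
edges, and any set of topology changes may occur between consecutive rounds. -/
structure DynamicGraph (n : ℕ) where
  topo : ℕ → Topology n
  starts_empty : (topo 0).graph = ⊥

/-- The topology before the changes that are indicated at the beginning of round `i`
(there are none in round `0`, where `0 - 1 = 0`). -/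
def DynamicGraph.prev {n : ℕ} (D : DynamicGraph n) (i : ℕ) : Topology n := D.topo (i - 1)

/-- The number of topology changes that occurred until (the beginning of) round `i`. -/
noncomputable def DynamicGraph.changes {n : ℕ} (D : DynamicGraph n) (i : ℕ) : ℕ :=
  ∑ j ∈ Finset.range i, changeCount (D.topo j) (D.topo (j + 1))

/-- What a node is told at the beginning of a round: the round number modulo `15 * n`, its current
neighbors, and the indications of the topology changes that have just occurred at it. -/
structure View (n : ℕ) where
  /-- the round number modulo `15 * n` -/
  clock : ℕ
  /-- whether the node itself has just been inserted -/
  inserted : Prop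
  /-- the current neighbors -/
  nbrs : Finset (Fin n)
  /-- other endpoints of incident edges that have just been inserted by an edge insertion -/
  edgeIns : Finset (Fin n)
  /-- other endpoints of incident edges that have just been deleted by an edge deletion -/
  edgeDel : Finset (Fin n)
  /-- current neighbors that are nodes which have just been inserted -/
  nodeIns : Finset (Fin n)
  /-- former neighbors that are nodes which have just been deleted -/
  nodeDel : Finset (Fin n)

open scoped Classical in
/-- The view of node `v` at the beginning of round `i`. -/
noncomputable def DynamicGraph.view {n : ℕ} (D : DynamicGraph n) (i : ℕ) (v : Fin n) : View n where
  clock := i % (15 * n)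
  inserted := v ∈ nodeInsertions (D.prev i) (D.topo i)
  nbrs := {u | (D.topo i).graph.Adj v u}
  edgeIns := {u | s(v, u) ∈ edgeInsertions (D.prev i) (D.topo i)}
  edgeDel := {u | s(v, u) ∈ edgeDeletions (D.prev i) (D.topo i)}
  nodeIns := {u | (D.topo i).graph.Adj v u ∧ u ∈ nodeInsertions (D.prev i) (D.topo i)}
  nodeDel := {u | (D.prev i).graph.Adj v u ∧ u ∈ nodeDeletions (D.prev i) (D.topo i)}

/-- A deterministic synchronous distributed algorithm that maintains a label in
`{true, false}` at each node. Nodes know `n` and their identifier (through `init`). In each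
round a node computes, from its state and its view, a bit string for each neighbor; these are
delivered in the same round, and the node then updates its state. -/
structure Algorithm where
  /-- local states of the nodes in a system of at most `n` nodes -/
  State : ℕ → Type
  /-- state of an initial or newly inserted node with the given identifier -/
  init : (n : ℕ) → Fin n → State n
  /-- the label stored in a state -/
  label : (n : ℕ) → State n → Bool
  /-- the message to the given neighbor -/
  send : (n : ℕ) → State n → View n → Fin n → List Bool
  /-- the new state, given the messages received (`none` from nodes that are not neighbors) -/
  update : (n : ℕ) → State n → View n → (Fin n → Option (List Bool)) → State n

namespace Algorithm

/-- The messages that `v` receives in round `i`, when `s` are the states at its beginning. -/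
noncomputable def inbox (A : Algorithm) {n : ℕ} (D : DynamicGraph n) (i : ℕ)
    (s : Fin n → A.State n) (v : Fin n) : Fin n → Option (List Bool) :=
  open scoped Classical in
  fun u => if (D.topo i).graph.Adj u v then some (A.send n (s u) (D.view i u) v) else none

/-- `A.state D i v` is the state of `v` at the beginning of round `i` (meaningful for nodes that
are present). A node that is not present in round `i` loses its state: if it is inserted later,
then it is a new node and starts from the initial state. -/
noncomputable def state (A : Algorithm) {n : ℕ} (D : DynamicGraph n) :
    ℕ → Fin n → A.State n
  | 0, v => A.init n v
  | i + 1, v =>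
    if v ∈ (D.topo i).nodes then
      A.update n (A.state D i v) (D.view i v) (A.inbox D i (A.state D i) v)
    else A.init n v

/-- The label of `v` at the beginning of round `i`. -/
noncomputable def labelAt (A : Algorithm) {n : ℕ} (D : DynamicGraph n) (i : ℕ) (v : Fin n) :
    Bool :=
  A.label n (A.state D i v)

/-- All messages of `A` have at most `C * log n` bits. -/
def MessageBitsLE (A : Algorithm) (C : ℕ) : Prop :=
  ∀ n : ℕ, 2 ≤ n → ∀ (s : A.State n) (w : View n) (u : Fin n),
    (A.send n s w u).length ≤ C * Nat.log 2 n

end Algorithm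

/-- The star centered at `v` is consistently labeled for the maximal independent set problem:
a node labeled `true` has only neighbors labeled `false`, and a node labeled `false` has a
neighbor labeled `true`. -/
def StarConsistent {n : ℕ} (T : Topology n) (L : Fin n → Bool) (v : Fin n) : Prop :=
  (L v = true → ∀ u, T.graph.Adj v u → L u = false) ∧
    (L v = false → ∃ u, T.graph.Adj v u ∧ L u = true)

namespace Algorithm

/-- Round `i` is incorrect: some node of the current graph has an inconsistent star. -/
def IncorrectRound (A : Algorithm) {n : ℕ} (D : DynamicGraph n) (i : ℕ) : Prop :=
  ∃ v ∈ (D.topo i).nodes, ¬ StarConsistent (D.topo i) (A.labelAt D i) v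

/-- The number of incorrect rounds until round `i` (inclusive). -/
noncomputable def incorrect (A : Algorithm) {n : ℕ} (D : DynamicGraph n) (i : ℕ) : ℕ :=
  {j | j ≤ i ∧ A.IncorrectRound D j}.ncard

/-- `A` fixes maximal independent sets with amortized round complexity at most `k`, under edge and
node insertions and deletions: in every dynamic network, until every round, the number of incorrect
rounds is at most `k` times the number of changes. As long as no change has occurred, this says
that all stars are consistent; in particular they are so in round `0`. -/
def AmortizedRoundsLE (A : Algorithm) (k : ℕ) : Prop :=
  ∀ (n : ℕ) (D : DynamicGraph n) (i : ℕ), A.incorrect D i ≤ k * D.changes i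

end Algorithm

end DynNet

/-! After each update no edge on which the messages travelled joins two nodes labeled `true`: of two
conflicting nodes the larger leaves, and a joining node has no active neighbor and beats its flagged
neighbors. A just inserted node counts as inactive, so however many edges it brings, it evicts
nobody. Hence edges between active nodes come from edge insertions, and departures are charged
injectively to these (`ncard_leaves_le`). A present node becomes inactive only by insertion or
departure, and each join ends one inactivity, so there are at most as many joins as changes
(`sum_joining_le`). If a round is incorrect, then it had changes, or a node joins in it, or the
previous round had a join or a new edge (`incorrectRound_succ`): otherwise activity is frozen, some
uncovered node is flagged, and the least flagged node joins. Changes and joins are each charged at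
most twice, whence the factor 2 + 2 = 4. -/

namespace DynNet

/-- The state of a node in `misAlgorithm`. -/
structure MISState (n : ℕ) where
  /-- the identifier of the node -/
  id : Fin n
  /-- the label -/
  inMIS : Bool
  /-- whether the node was uncovered in the previous round: neither it nor a neighbor was active -/
  wasUncovered : Bool

open scoped Classical in
/-- Maintains a maximal independent set. A node is *active* if it is labeled `true` and has not
just been inserted. Every node tells its neighbors whether it is active and whether it was uncovered
in the previous round. An active node leaves the set if it has an active neighbor with a smaller
identifier. An uncovered node joins the set if it was uncovered in the previous round, too, and no
neighbor with a smaller identifier was. -/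
noncomputable def misAlgorithm : Algorithm where
  State := MISState
  init _ v := ⟨v, true, false⟩
  label _ s := s.inMIS
  send _ s w _ := [decide (s.inMIS = true ∧ ¬ w.inserted), s.wasUncovered]
  update _ s w m :=
    { id := s.id
      inMIS := decide (
        ((s.inMIS = true ∧ ¬ w.inserted) ∧ ∀ u < s.id, ∀ b, m u ≠ some [true, b]) ∨
        (¬ (s.inMIS = true ∧ ¬ w.inserted) ∧ (∀ u b, m u ≠ some [true, b]) ∧
          s.wasUncovered = true ∧ ∀ u < s.id, ∀ b, m u ≠ some [b, true]))
      wasUncovered := decide (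
        ¬ (s.inMIS = true ∧ ¬ w.inserted) ∧ ∀ u b, m u ≠ some [true, b]) }

theorem misAlgorithm_messageBitsLE : misAlgorithm.MessageBitsLE 2 := by
  intro n hn s w u
  have : 1 ≤ Nat.log 2 n := Nat.log_pos (by norm_num) hn
  change 2 ≤ 2 * Nat.log 2 n
  omega

/-! ### Counting topology changes -/

section Topology

variable {n : ℕ}

theorem nodeInsertions_ncard_add_edgeInsertions_ncard_le (T T' : Topology n) :
    (nodeInsertions T T').ncard + (edgeInsertions T T').ncard ≤ changeCount T T' := by
  unfold changeCount; omega

@[simp]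
theorem nodeInsertions_self (T : Topology n) : nodeInsertions T T = ∅ := by
  ext v; simp [nodeInsertions]

@[simp]
theorem edgeInsertions_self (T : Topology n) : edgeInsertions T T = ∅ := by
  ext e; simp only [edgeInsertions, Set.mem_ofPred_eq, Set.mem_empty_iff_false]; tauto

/-- Without changes, a transition preserves nodes and adjacency. -/
theorem eq_of_changeCount_eq_zero {T T' : Topology n} (h : changeCount T T' = 0) :
    T.nodes = T'.nodes ∧ ∀ u v, T.graph.Adj u v ↔ T'.graph.Adj u v := by
  have h1 : nodeInsertions T T' = ∅ := by
    rw [← Set.ncard_eq_zero]; unfold changeCount at h; omega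
  have h2 : nodeDeletions T T' = ∅ := by
    rw [← Set.ncard_eq_zero]; unfold changeCount at h; omega
  have h3 : edgeInsertions T T' = ∅ := by
    rw [← Set.ncard_eq_zero]; unfold changeCount at h; omega
  have h4 : edgeDeletions T T' = ∅ := by
    rw [← Set.ncard_eq_zero]; unfold changeCount at h; omega
  have hn : T.nodes = T'.nodes := by
    ext v
    have a : v ∉ nodeInsertions T T' := by simp [h1]
    have b : v ∉ nodeDeletions T T' := by simp [h2]
    simp only [nodeInsertions, nodeDeletions, Set.mem_ofPred_eq] at a b
    tauto
  refine ⟨hn, fun u v => ⟨fun h => ?_, fun h => ?_⟩⟩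
  · by_contra hc
    have : s(u, v) ∈ edgeDeletions T T' := by
      simpa [edgeDeletions, h, hc, ← hn] using T.mem_of_adj _ _ h
    simp [h4] at this
  · by_contra hc
    have : s(u, v) ∈ edgeInsertions T T' := by
      simpa [edgeInsertions, h, hc, hn] using T'.mem_of_adj _ _ h
    simp [h3] at this

end Topology

/-! ### The algorithm as a global dynamics on active and flagged nodes -/

namespace DynamicGraph

variable {n : ℕ} (D : DynamicGraph n)

/-- The edges inserted just before round `i`. -/
def newEdges (i : ℕ) : Set (Sym2 (Fin n)) := edgeInsertions (D.prev i) (D.topo i)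

@[simp]
theorem newEdges_zero : D.newEdges 0 = ∅ := by simp [newEdges, prev]

theorem changes_succ (i : ℕ) :
    D.changes (i + 1) = D.changes i + changeCount (D.topo i) (D.topo (i + 1)) := by
  simp [changes, Finset.sum_range_succ]

/-- `v` is labeled `true` and has not just been inserted. -/
def Active (i : ℕ) (v : Fin n) : Prop :=
  misAlgorithm.labelAt D i v = true ∧ v ∉ nodeInsertions (D.prev i) (D.topo i)

/-- Neither `v` nor any of its neighbors is active. -/
def Uncovered (i : ℕ) (v : Fin n) : Prop :=
  ¬ D.Active i v ∧ ∀ u, (D.topo i).graph.Adj v u → ¬ D.Active i u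

/-- `v` remembers to have been uncovered in the previous round. -/
def Flagged (i : ℕ) (v : Fin n) : Prop :=
  MISState.wasUncovered (misAlgorithm.state D i v) = true

/-- `v` joins the independent set in round `i`. -/
def Joins (i : ℕ) (v : Fin n) : Prop :=
  D.Uncovered i v ∧ D.Flagged i v ∧ ∀ u < v, (D.topo i).graph.Adj v u → ¬ D.Flagged i u

/-- `v` leaves the independent set in round `i`. -/
def Leaves (i : ℕ) (v : Fin n) : Prop :=
  D.Active i v ∧ ∃ u < v, (D.topo i).graph.Adj v u ∧ D.Active i u

theorem state_id (i : ℕ) (v : Fin n) : MISState.id (misAlgorithm.state D i v) = v := by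
  induction i with
  | zero => rfl
  | succ i ih =>
    rw [Algorithm.state]
    split_ifs
    · exact ih
    · rfl

theorem inbox_eq_active_iff (i : ℕ) (v u : Fin n) :
    (∃ b, misAlgorithm.inbox D i (misAlgorithm.state D i) v u = some [true, b]) ↔
      (D.topo i).graph.Adj v u ∧ D.Active i u := by
  by_cases h : (D.topo i).graph.Adj u v
  · simp [Algorithm.inbox, h, h.symm, misAlgorithm, Active, Algorithm.labelAt, view]
  · simp [Algorithm.inbox, h, mt SimpleGraph.Adj.symm h]

theorem inbox_eq_flagged_iff (i : ℕ) (v u : Fin n) :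
    (∃ b, misAlgorithm.inbox D i (misAlgorithm.state D i) v u = some [b, true]) ↔
      (D.topo i).graph.Adj v u ∧ D.Flagged i u := by
  by_cases h : (D.topo i).graph.Adj u v
  · simp [Algorithm.inbox, h, h.symm, misAlgorithm, Flagged]
  · simp [Algorithm.inbox, h, mt SimpleGraph.Adj.symm h]

theorem flagged_succ_iff {i : ℕ} {v : Fin n} (hv : v ∈ (D.topo i).nodes) :
    D.Flagged (i + 1) v ↔ D.Uncovered i v := by
  have key : (∀ u b, misAlgorithm.inbox D i (misAlgorithm.state D i) v u ≠ some [true, b]) ↔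
      ∀ u, (D.topo i).graph.Adj v u → ¬ D.Active i u := by
    refine forall_congr' fun u => ?_
    have := D.inbox_eq_active_iff i v u
    rw [← not_exists, this, not_and]
  rw [Flagged, Algorithm.state, if_pos hv, Uncovered, ← key]
  exact @decide_eq_true_iff _ (_)

theorem labelAt_succ_iff {i : ℕ} {v : Fin n} (hv : v ∈ (D.topo i).nodes) :
    misAlgorithm.labelAt D (i + 1) v = true ↔
      D.Active i v ∧ ¬ D.Leaves i v ∨ D.Joins i v := by
  have key (u : Fin n) :
      (∀ b, misAlgorithm.inbox D i (misAlgorithm.state D i) v u ≠ some [true, b]) ↔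
      ((D.topo i).graph.Adj v u → ¬ D.Active i u) := by
    rw [← not_exists, D.inbox_eq_active_iff i v u, not_and]
  have key' (u : Fin n) :
      (∀ b, misAlgorithm.inbox D i (misAlgorithm.state D i) v u ≠ some [b, true]) ↔
      ((D.topo i).graph.Adj v u → ¬ D.Flagged i u) := by
    rw [← not_exists, D.inbox_eq_flagged_iff i v u, not_and]
  have hl : D.Active i v ∧ ¬ D.Leaves i v ↔ D.Active i v ∧
      ∀ u < v, (D.topo i).graph.Adj v u → ¬ D.Active i u := by
    simp only [Leaves, not_and, not_exists]; tauto
  rw [hl, Joins, Uncovered, and_assoc]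
  simp_rw [← key, ← key']
  rw [Algorithm.labelAt, Algorithm.state, if_pos hv]
  refine (@decide_eq_true_iff _ (_)).trans ?_
  rw [state_id]
  rfl

theorem not_flagged_succ_of_notMem {i : ℕ} {v : Fin n} (hv : v ∉ (D.topo i).nodes) :
    ¬ D.Flagged (i + 1) v := by
  rw [Flagged, Algorithm.state, if_neg hv]; exact Bool.false_ne_true

theorem active_zero (v : Fin n) : D.Active 0 v := ⟨rfl, by simp [prev]⟩

theorem mem_newEdges_succ {i : ℕ} {u v : Fin n} (h : (D.topo (i + 1)).graph.Adj u v)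
    (h' : ¬ (D.topo i).graph.Adj u v) (hu : u ∈ (D.topo i).nodes) (hv : v ∈ (D.topo i).nodes) :
    s(u, v) ∈ D.newEdges (i + 1) := by
  simp [newEdges, prev, edgeInsertions, h, h', hu, hv]

theorem Active.mem_of_mem_succ {D : DynamicGraph n} {i : ℕ} {v : Fin n}
    (h : D.Active (i + 1) v) (hv : v ∈ (D.topo (i + 1)).nodes) : v ∈ (D.topo i).nodes := by
  by_contra hc
  exact h.2 ⟨hv, hc⟩

/-- If both were active, the larger would leave; a joining node has no active neighbor; and of two
adjacent flagged nodes only the smaller can join. -/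
theorem not_labelAt_succ_of_adj {i : ℕ} {u v : Fin n} (huv : u < v)
    (h : (D.topo i).graph.Adj v u) (hu : misAlgorithm.labelAt D (i + 1) u = true) :
    ¬ misAlgorithm.labelAt D (i + 1) v = true := by
  obtain ⟨hv', hu'⟩ := (D.topo i).mem_of_adj _ _ h
  rw [labelAt_succ_iff D hu'] at hu
  rw [labelAt_succ_iff D hv']
  rintro (⟨hv, hvl⟩ | hv)
  · rcases hu with ⟨hu, -⟩ | hu
    · exact hvl ⟨hv, u, huv, h, hu⟩
    · exact hu.1.2 v h.symm hv
  · rcases hu with ⟨hu, -⟩ | hu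
    · exact hv.1.2 u h hu
    · exact hv.2.2 u huv h hu.2.1

/-! ### Amortization of departures and joins -/

/-- Edges between active nodes have just been inserted. -/
theorem mem_newEdges_of_active {i : ℕ} {u v : Fin n} (h : (D.topo i).graph.Adj u v)
    (hu : D.Active i u) (hv : D.Active i v) : s(u, v) ∈ D.newEdges i := by
  rcases i with - | i
  · rw [D.starts_empty] at h; exact h.elim
  obtain ⟨mu, mv⟩ := (D.topo (i + 1)).mem_of_adj _ _ h
  refine D.mem_newEdges_succ h (fun h' => ?_) (hu.mem_of_mem_succ mu) (hv.mem_of_mem_succ mv)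
  rcases lt_or_gt_of_ne h.ne with hlt | hlt
  · exact D.not_labelAt_succ_of_adj hlt h'.symm hu.1 hv.1
  · exact D.not_labelAt_succ_of_adj hlt h' hv.1 hu.1

theorem ncard_leaves_le (i : ℕ) : {v | D.Leaves i v}.ncard ≤ (D.newEdges i).ncard := by
  -- Charge `v` to the edge to a smaller active neighbor `f v`. Injectivity: `v` is recovered as the
  -- larger endpoint.
  choose! f hf using fun v (hv : v ∈ {v | D.Leaves i v}) => hv.2
  refine Set.ncard_le_ncard_of_injOn (fun v => s(v, f v)) (fun v hv => ?_) ?_ (Set.toFinite _)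
  · obtain ⟨-, h, ha⟩ := hf v hv
    exact D.mem_newEdges_of_active h hv.1 ha
  · intro v hv w hw h
    rcases Sym2.eq_iff.1 h with h | ⟨h, h'⟩
    · exact h.1
    · have h1 := (hf v hv).1
      have h2 := (hf w hw).1
      rw [h'] at h1
      rw [← h] at h2
      exact absurd h1 h2.asymm

/-- The present nodes that are not active. -/
def inactive (i : ℕ) : Set (Fin n) := {v | v ∈ (D.topo i).nodes ∧ ¬ D.Active i v}

/-- The present nodes that join the independent set in round `i`. -/
def joining (i : ℕ) : Set (Fin n) := {v | v ∈ (D.topo i).nodes ∧ D.Joins i v}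

theorem joining_subset_inactive (i : ℕ) : D.joining i ⊆ D.inactive i :=
  fun _ hv => ⟨hv.1, hv.2.1.1⟩

theorem inactive_succ_subset (i : ℕ) :
    D.inactive (i + 1) ⊆ nodeInsertions (D.topo i) (D.topo (i + 1)) ∪
      ((D.inactive i \ D.joining i) ∪ {v | D.Leaves i v}) := by
  rintro v ⟨hv, ha⟩
  by_cases hi : v ∈ nodeInsertions (D.topo i) (D.topo (i + 1))
  · exact Or.inl hi
  refine Or.inr ?_
  have hv' : v ∈ (D.topo i).nodes := by
    by_contra hc
    exact hi ⟨hv, hc⟩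
  have hl : ¬ misAlgorithm.labelAt D (i + 1) v = true := fun hl => ha ⟨hl, hi⟩
  rw [labelAt_succ_iff D hv', not_or, not_and_not_right] at hl
  by_cases hva : D.Active i v
  · exact Or.inr (hl.1 hva)
  · exact Or.inl ⟨⟨hv', hva⟩, fun h => hl.2 h.2⟩

theorem ncard_inactive_succ_add_le (i : ℕ) :
    (D.inactive (i + 1)).ncard + (D.joining i).ncard ≤
      (nodeInsertions (D.topo i) (D.topo (i + 1))).ncard + (D.inactive i).ncard +
        (D.newEdges i).ncard := by
  have h1 := Set.ncard_le_ncard (D.inactive_succ_subset i) (Set.toFinite _)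
  have h2 := Set.ncard_union_le (nodeInsertions (D.topo i) (D.topo (i + 1)))
    ((D.inactive i \ D.joining i) ∪ {v | D.Leaves i v})
  have h3 := Set.ncard_union_le (D.inactive i \ D.joining i) {v | D.Leaves i v}
  have h4 := Set.ncard_sdiff_add_ncard_of_subset (D.joining_subset_inactive i) (Set.toFinite _)
  have h5 := D.ncard_leaves_le i
  omega

/-- Potential argument. An inserted edge is paid for when it appears; one round later its payment
covers the inactivity of the node that it may evict, and a join turns inactivity into a term of the
sum. -/
theorem ncard_inactive_add_sum_joining_le (i : ℕ) :
    (D.inactive i).ncard + ∑ j ∈ Finset.range i, (D.joining j).ncard + (D.newEdges i).ncard ≤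
      D.changes i := by
  induction i with
  | zero =>
    have : D.inactive 0 = ∅ := by ext v; simp [inactive, active_zero]
    simp [this]
  | succ i ih =>
    have h1 := D.ncard_inactive_succ_add_le i
    have h2 := nodeInsertions_ncard_add_edgeInsertions_ncard_le (D.topo i) (D.topo (i + 1))
    change _ + (D.newEdges (i + 1)).ncard ≤ _ at h2
    rw [Finset.sum_range_succ, changes_succ]
    omega

/-- The total number of times that a node joins is at most the number of changes. -/
theorem sum_joining_le (i : ℕ) :
    ∑ j ∈ Finset.range (i + 1), (D.joining j).ncard ≤ D.changes i := by
  have h1 := D.ncard_inactive_add_sum_joining_le i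
  have h2 := Set.ncard_le_ncard (D.joining_subset_inactive i) (Set.toFinite _)
  rw [Finset.sum_range_succ]
  omega

/-! ### Counting incorrect rounds -/

theorem not_incorrectRound_zero : ¬ misAlgorithm.IncorrectRound D 0 := by
  rintro ⟨v, -, h⟩
  refine h ⟨fun _ u hu => ?_, fun hl => absurd hl ?_⟩
  · rw [D.starts_empty] at hu; exact hu.elim
  · exact Bool.noConfusion

/-- An inconsistent star in a round without conflicts has an uncovered center. -/
theorem exists_uncovered_of_incorrectRound {i : ℕ}
    (h : misAlgorithm.IncorrectRound D i) (hn : nodeInsertions (D.prev i) (D.topo i) = ∅)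
    (he : D.newEdges i = ∅) : ∃ v ∈ (D.topo i).nodes, D.Uncovered i v := by
  obtain ⟨v, hv, h⟩ := h
  have ha (u : Fin n) : D.Active i u ↔ misAlgorithm.labelAt D i u = true := by simp [Active, hn]
  refine ⟨v, hv, ?_⟩
  by_contra hu
  refine h ⟨fun hl u hadj => ?_, fun hl => ?_⟩
  · rw [← Bool.not_eq_true, ← ha]
    intro hau
    have := D.mem_newEdges_of_active hadj ((ha v).2 hl) hau
    simp [he] at this
  · simpa [Uncovered, ha, hl] using hu

/-- In an incorrect round, there are changes, some node joins, or in the previous round some node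
joined or some edge was new. -/
theorem incorrectRound_succ {i : ℕ} (h : misAlgorithm.IncorrectRound D (i + 1)) :
    changeCount (D.topo i) (D.topo (i + 1)) ≠ 0 ∨ (D.joining (i + 1)).Nonempty ∨
      (D.joining i).Nonempty ∨ (D.newEdges i).Nonempty := by
  by_contra! hc
  obtain ⟨hc, hj', hj, he⟩ := hc
  obtain ⟨hnodes, hadj⟩ := eq_of_changeCount_eq_zero hc
  have hle := nodeInsertions_ncard_add_edgeInsertions_ncard_le (D.topo i) (D.topo (i + 1))
  have hn' : nodeInsertions (D.prev (i + 1)) (D.topo (i + 1)) = ∅ := by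
    rw [← Set.ncard_eq_zero]; change Set.ncard (nodeInsertions (D.topo i) _) = 0; omega
  have he' : D.newEdges (i + 1) = ∅ := by
    rw [← Set.ncard_eq_zero]
    change Set.ncard (edgeInsertions (D.topo i) (D.topo (i + 1))) = 0; omega
  -- A departure would need a new edge in round `i`, and nobody joins, so activity is unchanged.
  have hstay {u : Fin n} (hu : u ∈ (D.topo i).nodes) : D.Active (i + 1) u ↔ D.Active i u := by
    have hl : ¬ D.Leaves i u := by
      rintro ⟨hu, w, -, hw, hwa⟩
      have := D.mem_newEdges_of_active hw hu hwa
      simp [he] at this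
    have hnj : ¬ D.Joins i u := fun h => by
      have : u ∈ D.joining i := ⟨hu, h⟩
      simp [hj] at this
    rw [Active, hn', labelAt_succ_iff D hu]
    simp [hl, hnj]
  have hunc {u : Fin n} (hu : u ∈ (D.topo i).nodes) :
      D.Uncovered (i + 1) u ↔ D.Uncovered i u := by
    refine and_congr (not_congr (hstay hu)) (forall_congr' fun w => ?_)
    rw [← hadj]
    refine forall_congr' fun hw => not_congr (hstay ((D.topo i).mem_of_adj _ _ hw).2)
  obtain ⟨v, hv, hvu⟩ := D.exists_uncovered_of_incorrectRound h hn' he'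
  rw [← hnodes] at hv
  -- The flags record who was uncovered in round `i`, and these nodes still are; the globally least
  -- flagged node has no flagged smaller neighbor.
  obtain ⟨w, hw, hmin⟩ := (Set.toFinite {w | D.Flagged (i + 1) w}).toFinset.exists_minimal
    ⟨v, by simpa [flagged_succ_iff D hv] using (hunc hv).1 hvu⟩
  simp only [Set.Finite.mem_toFinset, Set.mem_ofPred_eq] at hw hmin
  -- Absent nodes are reset to the initial state, whose flag is off.
  have hwn : w ∈ (D.topo i).nodes := by
    by_contra hwn
    exact D.not_flagged_succ_of_notMem hwn hw
  have : w ∈ D.joining (i + 1) := by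
    refine ⟨hnodes ▸ hwn, (hunc hwn).2 ((flagged_succ_iff D hwn).1 hw), hw, fun u hu _ hf => ?_⟩
    exact absurd (hmin hf hu.le) hu.not_ge
  simp [hj'] at this

theorem incorrect_succ_le (i : ℕ) :
    misAlgorithm.incorrect D (i + 1) ≤ misAlgorithm.incorrect D i + 1 := by
  have hs : {j | j ≤ i + 1 ∧ misAlgorithm.IncorrectRound D j} ⊆
      insert (i + 1) {j | j ≤ i ∧ misAlgorithm.IncorrectRound D j} := by
    rintro j ⟨hj, h⟩
    rcases Nat.le_succ_iff.1 hj with hj | rfl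
    · exact Or.inr ⟨hj, h⟩
    · exact Or.inl rfl
  have hf : {j | j ≤ i ∧ misAlgorithm.IncorrectRound D j}.Finite :=
    (Set.finite_Iic i).subset fun j hj => hj.1
  exact (Set.ncard_le_ncard hs (hf.insert _)).trans (Set.ncard_insert_le _ _)

theorem incorrect_succ_of_not {i : ℕ} (h : ¬ misAlgorithm.IncorrectRound D (i + 1)) :
    misAlgorithm.incorrect D (i + 1) = misAlgorithm.incorrect D i := by
  unfold Algorithm.incorrect
  congr 1
  ext j
  simp only [Set.mem_ofPred_eq]
  refine and_congr_left fun hj => ⟨fun hle => ?_, fun hle => by omega⟩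
  rcases Nat.le_succ_iff.1 hle with hle | rfl
  · exact hle
  · exact absurd hj h

/-- Each change pays for its own round and, if it is an edge insertion, for the next one: the term
`newEdges` holds this second payment in reserve. Each join pays for its own round and the next,
hence the two shifted sums. -/
theorem incorrect_add_le (i : ℕ) :
    misAlgorithm.incorrect D i + (D.newEdges i).ncard ≤ 2 * D.changes i +
      ∑ j ∈ Finset.range (i + 1), (D.joining j).ncard +
      ∑ j ∈ Finset.range i, (D.joining j).ncard := by
  induction i with
  | zero =>
    have : {j | j ≤ 0 ∧ misAlgorithm.IncorrectRound D j} = ∅ := by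
      ext j
      simp only [Set.mem_ofPred_eq, Set.mem_empty_iff_false, iff_false, not_and, Nat.le_zero]
      rintro rfl
      exact D.not_incorrectRound_zero
    have h0 : misAlgorithm.incorrect D 0 = 0 := by rw [Algorithm.incorrect, this, Set.ncard_empty]
    simp [h0]
  | succ i ih =>
    have h2 := nodeInsertions_ncard_add_edgeInsertions_ncard_le (D.topo i) (D.topo (i + 1))
    change _ + (D.newEdges (i + 1)).ncard ≤ _ at h2
    rw [Finset.sum_range_succ, Finset.sum_range_succ _ i, changes_succ]
    rw [Finset.sum_range_succ] at ih
    by_cases h : misAlgorithm.IncorrectRound D (i + 1)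
    · have h1 := D.incorrect_succ_le i
      have h3 : 1 ≤ changeCount (D.topo i) (D.topo (i + 1)) + (D.joining (i + 1)).ncard +
          (D.joining i).ncard + (D.newEdges i).ncard := by
        rcases D.incorrectRound_succ h with h | h | h | h
        · omega
        all_goals
          have := (Set.ncard_pos (Set.toFinite _)).2 h
          omega
      omega
    · rw [D.incorrect_succ_of_not h]
      omega

end DynamicGraph

theorem misAlgorithm_amortizedRoundsLE : misAlgorithm.AmortizedRoundsLE 4 := by
  intro n D i
  have h1 := D.incorrect_add_le i
  have h2 := D.sum_joining_le i
  have h3 := D.ncard_inactive_add_sum_joining_le i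
  omega

end DynNet

theorem mainTheorem1 :
    ∃ (A : DynNet.Algorithm) (C k : ℕ), A.MessageBitsLE C ∧ A.AmortizedRoundsLE k :=
  ⟨DynNet.misAlgorithm, 2, 4, DynNet.misAlgorithm_messageBitsLE,
    DynNet.misAlgorithm_amortizedRoundsLE⟩
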